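/- Let $p>0$ and, for units $i=1,2,\dots$ and sample sizes $T=1,2,\dots$, let $\theta_i$ be real random variables with distribution $F$ and $\varepsilon_{i,T}$ real random variables with distribution $G_T$, such that for each $T$ the pairs $(\theta_i,\varepsilon_{i,T})_i$ are independent and identically distributed over $i$ (the dependence within a pair is unrestricted) and the family $\{G_T\}_T$ is tight. Write $\theta_{N,N}=\max(\theta_1,\dots,\theta_N)$. For a distribution function $H$ and $0<v\le 1$ let $H^{-1}(v)=\inf\{x: H(x)\ge v\}$ (equal to $+\infty$ if the set is empty), and let $H^{-1}(0)=\inf\{x:H(x)>0\}$. Let $N,T\to\infty$ jointly along an arbitrary regime (any sequence of pairs $(N,T)$, or more generally any filter on pairs, along which $N\to\infty$ and $T\to\infty$); all limits in $N,T$ below are along this regime. Let $\gamma'\in\mathbb R$ and suppose that one of the following holds: (1) for some $\beta>0$, $\sup_T \mathbb E|\varepsilon_{i,T}|^\beta<\infty$ and $N^{1/\beta-\gamma'}(\log T)^{1/\beta}/T^p\to 0$; (2) for every $T$, $\varepsilon_{i,T}\sim N(\mu_T,\sigma_T^2)$ for some $\mu_T\in\mathbb R$, $\sigma_T^2\ge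 0$, and $N^{-\gamma'}\sqrt{\log N}/T^p\to 0$. Suppose also that $F$ is in the weak domain of attraction of an extreme value distribution with extreme value index $\gamma>\gamma'$, i.e. there are $\alpha_n>0$ and $\beta_n\in\mathbb{R}$ with $F^n(\alpha_n x+\beta_n)\to \exp(-(1+\gamma x)^{-1/\gamma})$ for all real $x$ (read as $\exp(-e^{-x})$ if $\gamma=0$; where $1+\gamma x\le 0$ the limit is $0$ if $\gamma>0$ and $1$ if $\gamma<0$). Then for every sequence $(a_N,b_N)$ with $a_N>0$ for all large $N$ such that $(\theta_{N,N}-b_N)/a_N$ converges in distribution to a non-degenerate random variable, both tail equivalence conditions hold: (TE-Inf) for each $\tau\in(0,\infty)$, $$\inf_{u\in[0,\frac1{N\tau}]}\frac1{a_N}\Big(F^{-1}\big(1-\tfrac1{N\tau}+u\big)-F^{-1}\big(1-\tfrac1{N\tau}\big)+\tfrac1{T^p}G_T^{-1}(1-u)\Big)\to0;$$ (TE-Sup) for each $\tau\in(0,\infty)$ there is $\epsilon\in(0,1)$ such that $$\sup_{u\in[0,\epsilon]}\frac1{a_N}\Big(F^{-1}\big(1-\tfrac1{N\tau}-u\big)-F^{-1}\big(1-\tfrac1{N\tau}\big)+\tfrac1{T^p}G_T^{-1}(u)\Big)\to0.$$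 -/

import Mathlib

open MeasureTheory ProbabilityTheory Filter Topology

noncomputable section

/-- The (left-continuous, extended-real-valued) quantile function of a law `μ` on `ℝ`.
For `0 < v` it is `inf {x | v ≤ F x}`, with value `+∞` when that set is empty (only possible for
`1 ≤ v`); at `v = 0` it is the lower endpoint `inf {x | 0 < F x}` of the distribution. -/
def quantile (μ : Measure ℝ) (v : ℝ) : EReal :=
  sInf ((fun x : ℝ => (x : EReal)) '' {x : ℝ | v ≤ cdf μ x ∧ 0 < cdf μ x})

/-- The cdf of the extreme value distribution with extreme value index `γ`:
`exp (-(1 + γ x)^(-1/γ))` where `1 + γ x > 0`, read as `exp (-exp (-x))` for `γ = 0`. -/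
def evCdf (γ x : ℝ) : ℝ :=
  if γ = 0 then Real.exp (-Real.exp (-x))
  else if 0 < 1 + γ * x then Real.exp (-(1 + γ * x) ^ (-1 / γ))
  else if 0 < γ then 0 else 1

/-- `F` is in the weak domain of attraction of an extreme value distribution with index `γ`:
affinely normalized maxima of iid draws from `F` (with cdf `F^n`) converge weakly to it. The limit
cdf is continuous, so weak convergence is pointwise convergence of cdfs. -/
def InDomainOfAttraction (F : Measure ℝ) (γ : ℝ) : Prop :=
  ∃ a b : ℕ → ℝ, (∀ n, 0 < a n) ∧
    ∀ x : ℝ, Tendsto (fun n : ℕ => (cdf F (a n * x + b n)) ^ n) atTop (𝓝 (evCdf γ x))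

/-- The maximum of the first `N` observations `X 0, …, X (N - 1)` (for `1 ≤ N`). -/
def sampleMax {Ω : Type*} (X : ℕ → Ω → ℝ) (N : ℕ) (ω : Ω) : ℝ :=
  ⨆ i : Fin N, X i ω

/-- The sampling scheme: `θ i` is the effect of unit `i`, with law `F`, and `ε T i` is the scaled
estimation noise of unit `i` with per-unit sample size `T ≥ 1`, with law `G T`. For each `T` the
pairs `(θ i, ε T i)` are iid over `i`; the dependence within a pair is unrestricted. -/
structure IsNoisySample {Ω : Type*} [MeasurableSpace Ω] (P : Measure Ω)
    (θ : ℕ → Ω → ℝ) (ε : ℕ → ℕ → Ω → ℝ) (F : Measure ℝ) (G : ℕ → Measure ℝ) : Prop where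
  law_effect : ∀ i, HasLaw (θ i) F P
  law_noise : ∀ T, 0 < T → ∀ i, HasLaw (ε T i) (G T) P
  indep : ∀ T, 0 < T → iIndepFun (fun i ω => (θ i ω, ε T i ω)) P
  identDistrib : ∀ T, 0 < T → ∀ i j,
    IdentDistrib (fun ω => (θ i ω, ε T i ω)) (fun ω => (θ j ω, ε T j ω)) P P

/-- Tail equivalence, supremum condition. The filter `l` on pairs `(N, T)` is the asymptotic regime
along which `N, T → ∞`. -/
def TESup (F : Measure ℝ) (G : ℕ → Measure ℝ) (p : ℝ) (a : ℕ → ℝ) (l : Filter (ℕ × ℕ)) : Prop :=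
  ∀ τ : ℝ, 0 < τ → ∃ ϵ : ℝ, 0 < ϵ ∧ ϵ < 1 ∧
    Tendsto (fun q : ℕ × ℕ =>
      ⨆ u ∈ Set.Icc (0 : ℝ) ϵ,
        ((1 / a q.1 : ℝ) : EReal) *
          (quantile F (1 - 1 / (q.1 * τ) - u) - quantile F (1 - 1 / (q.1 * τ))
            + ((1 / (q.2 : ℝ) ^ p : ℝ) : EReal) * quantile (G q.2) u))
      l (𝓝 0)

/-- Tail equivalence, infimum condition. -/
def TEInf (F : Measure ℝ) (G : ℕ → Measure ℝ) (p : ℝ) (a : ℕ → ℝ) (l : Filter (ℕ × ℕ)) : Prop :=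
  ∀ τ : ℝ, 0 < τ →
    Tendsto (fun q : ℕ × ℕ =>
      ⨅ u ∈ Set.Icc (0 : ℝ) (1 / (q.1 * τ)),
        ((1 / a q.1 : ℝ) : EReal) *
          (quantile F (1 - 1 / (q.1 * τ) + u) - quantile F (1 - 1 / (q.1 * τ))
            + ((1 / (q.2 : ℝ) ^ p : ℝ) : EReal) * quantile (G q.2) (1 - u)))
      l (𝓝 0)

/-- Noise with uniformly bounded `β`-th absolute moments, and `N, T` growing so that
`N^(1/β - γ') (log T)^(1/β) / T^p → 0`. -/
def MomentRate {Ω : Type*} [MeasurableSpace Ω] (P : Measure Ω) (ε : ℕ → ℕ → Ω → ℝ)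
    (p γ' : ℝ) (l : Filter (ℕ × ℕ)) : Prop :=
  ∃ β : ℝ, 0 < β ∧
    (⨆ T ∈ Set.Ioi (0 : ℕ), ⨆ i : ℕ, ∫⁻ ω, ‖ε T i ω‖ₑ ^ β ∂P) < ⊤ ∧
    Tendsto (fun q : ℕ × ℕ =>
      (q.1 : ℝ) ^ (1 / β - γ') * Real.log q.2 ^ (1 / β) / (q.2 : ℝ) ^ p) l (𝓝 0)

/-- Gaussian noise (with mean and variance depending on `T`), and `N, T` growing so that
`N^(-γ') √(log N) / T^p → 0`. -/
def GaussianRate {Ω : Type*} [MeasurableSpace Ω] (P : Measure Ω) (ε : ℕ → ℕ → Ω → ℝ)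
    (p γ' : ℝ) (l : Filter (ℕ × ℕ)) : Prop :=
  (∀ T, 0 < T → ∃ (m : ℝ) (v : NNReal), ∀ i, HasLaw (ε T i) (gaussianReal m v) P) ∧
    Tendsto (fun q : ℕ × ℕ =>
      (q.1 : ℝ) ^ (-γ') * √(Real.log q.1) / (q.2 : ℝ) ^ p) l (𝓝 0)

end

/-! ### Quantile functions -/

/-! Both conditions reduce to sandwiches. For the upper bound in (TE-Inf), take `u = δ/N` with `δ`
small: the increment of the `F`-quantile between the levels `1 - 1/(Nτ)` and `1 - (1/τ - δ)/N` is a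
small multiple of `a_N`, while `G_T^{-1}(1 - δ/N)` is at most `C h(N)`, with `h(N) = N^{1/β}`
(Markov) or `√(log N)` (Gaussian tails). For the lower bound, every admissible `u` gives a
nonnegative `F`-increment, and `1 - u ≥ 1/2`, so tightness keeps the noise quantile above a constant
`-M`. (TE-Sup) is the mirror image.

What remains is `h(N)/(a_N T^p) → 0`, which follows from the rate condition once `a_N ≥ c N^{γ'}`.
First, `a_N` dominates the scale `α_N` of the extreme value normalization, since maxima normalized
by `a_N` are tight (`IsEVNormalization.exists_scale_le`). Second, comparing the normalizations at
`n` and `n/2` shows that doubling the sample size multiplies `α` by at least `2^{γ'}`, because the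
limiting factor `2^γ` is larger (`IsEVNormalization.eventually_mul_scale_half_le`); iterating gives
polynomial growth (`exists_rpow_le_of_mul_half_le`). -/

lemma quantile_le {μ : Measure ℝ} {v x : ℝ} (h : v ≤ cdf μ x) (h0 : 0 < cdf μ x) :
    quantile μ v ≤ x :=
  sInf_le ⟨x, ⟨h, h0⟩, rfl⟩

lemma le_quantile {μ : Measure ℝ} {v x : ℝ} (h : cdf μ x < v) : (x : EReal) ≤ quantile μ v := by
  refine le_sInf ?_
  rintro _ ⟨z, ⟨hz, -⟩, rfl⟩
  refine EReal.coe_le_coe_iff.2 (le_of_not_gt fun hzx => ?_)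
  exact absurd (hz.trans (monotone_cdf μ hzx.le)) (not_le.2 h)

lemma quantile_mono (μ : Measure ℝ) : Monotone (quantile μ) := fun _ _ h =>
  sInf_le_sInf (Set.image_mono fun _ hx => ⟨h.trans hx.1, hx.2⟩)

lemma exists_quantile_eq_coe (μ : Measure ℝ) {v : ℝ} (h0 : 0 < v) (h1 : v < 1) :
    ∃ r : ℝ, quantile μ v = r := by
  obtain ⟨x, hx⟩ := ((tendsto_order.1 (tendsto_cdf_atTop μ)).1 v h1).exists
  obtain ⟨z, hz⟩ := ((tendsto_order.1 (tendsto_cdf_atBot μ)).2 v h0).exists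
  have hu := quantile_le hx.le (h0.trans hx)
  have hl := le_quantile hz
  refine ⟨(quantile μ v).toReal, (EReal.coe_toReal ?_ ?_).symm⟩
  · exact (hu.trans_lt (EReal.coe_lt_top x)).ne
  · exact ((EReal.bot_lt_coe z).trans_le hl).ne'

/-- Two-sided tail bounds control the quantiles at the corresponding levels. -/
lemma quantile_le_of_measure_abs_ge_lt {μ : Measure ℝ} [IsProbabilityMeasure μ] {K δ : ℝ}
    (h : μ.real {x | K ≤ |x|} < δ) (hδ : δ < 1) : quantile μ (1 - δ) ≤ K := by
  have h1 : 1 - δ < cdf μ K := by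
    rw [cdf_eq_real]
    have h2 : μ.real (Set.Iic K)ᶜ ≤ μ.real {x | K ≤ |x|} :=
      measureReal_mono fun x hx => by
        simp only [Set.mem_compl_iff, Set.mem_Iic, not_le] at hx
        exact hx.le.trans (le_abs_self x)
    rw [measureReal_compl measurableSet_Iic, probReal_univ] at h2
    linarith
  exact quantile_le h1.le (by linarith)

lemma le_quantile_of_measure_abs_ge_lt {μ : Measure ℝ} [IsProbabilityMeasure μ] {K δ : ℝ}
    (h : μ.real {x | K ≤ |x|} < δ) : ((-K : ℝ) : EReal) ≤ quantile μ δ := by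
  refine le_quantile (lt_of_le_of_lt ?_ h)
  rw [cdf_eq_real]
  refine measureReal_mono fun x hx => ?_
  simp only [Set.mem_Iic] at hx
  exact (by linarith : K ≤ -x).trans (neg_le_abs x)

/-! ### Quantiles of the extreme value distribution -/

/-- The point at which `evCdf γ` takes the value `exp (-t)`. -/
noncomputable def evQuantile (γ t : ℝ) : ℝ :=
  if γ = 0 then -Real.log t else (t ^ (-γ) - 1) / γ

lemma evCdf_evQuantile (γ : ℝ) {t : ℝ} (ht : 0 < t) :
    evCdf γ (evQuantile γ t) = Real.exp (-t) := by
  by_cases hγ : γ = 0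
  · simp [evCdf, evQuantile, hγ, Real.exp_log ht]
  · have h1 : 1 + γ * evQuantile γ t = t ^ (-γ) := by
      simp only [evQuantile, if_neg hγ]
      field_simp
      ring
    have h2 : (t ^ (-γ)) ^ (-1 / γ) = t := by
      rw [← Real.rpow_mul ht.le]
      have : -γ * (-1 / γ) = 1 := by field_simp
      rw [this, Real.rpow_one]
    simp only [evCdf, if_neg hγ, h1, Real.rpow_pos_of_pos ht, if_true, h2]

lemma continuousAt_evQuantile (γ : ℝ) {t : ℝ} (ht : 0 < t) : ContinuousAt (evQuantile γ) t := by
  by_cases hγ : γ = 0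
  · have : evQuantile γ = fun s => -Real.log s := by ext; simp [evQuantile, hγ]
    rw [this]
    exact (Real.continuousAt_log ht.ne').neg
  · have : evQuantile γ = fun s => (s ^ (-γ) - 1) / γ := by ext; simp [evQuantile, hγ]
    rw [this]
    exact ((Real.continuousAt_rpow_const _ _ (Or.inl ht.ne')).sub continuousAt_const).div_const _

lemma evQuantile_lt {γ s t : ℝ} (hs : 0 < s) (hst : s < t) :
    evQuantile γ t < evQuantile γ s := by
  rcases lt_trichotomy γ 0 with hγ | rfl | hγ
  · simp only [evQuantile, if_neg hγ.ne]
    refine div_lt_div_of_neg_of_lt hγ ?_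
    have := Real.rpow_lt_rpow hs.le hst (neg_pos.2 hγ)
    linarith
  · simpa [evQuantile] using Real.log_lt_log hs hst
  · simp only [evQuantile, if_neg hγ.ne']
    refine div_lt_div_of_pos_right ?_ hγ
    have := Real.rpow_lt_rpow_of_neg hs hst (neg_lt_zero.2 hγ)
    linarith

/-- Homogeneity of degree `-γ`. With `c = 2` it is how the index enters the growth of the scale. -/
lemma evQuantile_mul_sub (γ : ℝ) {c s t : ℝ} (hc : 0 < c) (hs : 0 < s) (ht : 0 < t) :
    evQuantile γ (c * s) - evQuantile γ (c * t) =
      c ^ (-γ) * (evQuantile γ s - evQuantile γ t) := by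
  by_cases hγ : γ = 0
  · simp [evQuantile, hγ, Real.log_mul hc.ne' hs.ne', Real.log_mul hc.ne' ht.ne']
  · simp only [evQuantile, if_neg hγ, Real.mul_rpow hc.le hs.le, Real.mul_rpow hc.le ht.le]
    ring

/-! ### Affinely normalized maxima -/

/-- Monotonicity of the cdf turns an order between limiting probabilities into an order between
points, which is how locations and scales get compared below. -/
lemma eventually_lt_of_tendsto_pow_cdf {F : Measure ℝ} {x y : ℕ → ℝ} {L M : ℝ}
    (hx : Tendsto (fun n => cdf F (x n) ^ n) atTop (𝓝 L))
    (hy : Tendsto (fun n => cdf F (y n) ^ n) atTop (𝓝 M)) (h : L < M) :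
    ∀ᶠ n in atTop, x n < y n := by
  filter_upwards [hx.eventually_lt hy h] with n hn
  by_contra! hle
  exact absurd (pow_le_pow_left₀ (cdf_nonneg F _) (monotone_cdf F hle) n) (not_le.2 hn)

/-- The normalization of the maxima, parametrized by the limiting number `t` of exceedances. -/
def IsEVNormalization (F : Measure ℝ) (γ : ℝ) (α β : ℕ → ℝ) : Prop :=
  (∀ n, 0 < α n) ∧ ∀ t, 0 < t →
    Tendsto (fun n : ℕ => cdf F (α n * evQuantile γ t + β n) ^ n) atTop (𝓝 (Real.exp (-t)))

lemma InDomainOfAttraction.exists_isEVNormalization {F : Measure ℝ} {γ : ℝ}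
    (h : InDomainOfAttraction F γ) : ∃ α β, IsEVNormalization F γ α β := by
  obtain ⟨α, β, hα, h⟩ := h
  exact ⟨α, β, hα, fun t ht => by simpa only [evCdf_evQuantile γ ht] using h (evQuantile γ t)⟩

lemma tendsto_one_sub_div_pow (t : ℝ) :
    Tendsto (fun n : ℕ => (1 - t / n) ^ n) atTop (𝓝 (Real.exp (-t))) := by
  simpa [neg_div, ← sub_eq_add_neg] using Real.tendsto_one_add_div_pow_exp (-t)

lemma eventually_div_natCast_lt_one (t : ℝ) : ∀ᶠ n : ℕ in atTop, t / n < 1 :=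
  (tendsto_order.1 (tendsto_const_div_atTop_nhds_zero_nat t)).2 1 one_pos

/-- The `n`-th power of the level tends to `exp (-t) < exp (-s)`, so comparing `n`-th powers
compares the level with the cdf at the point. The next lemma is the mirror image. -/
lemma IsEVNormalization.eventually_quantile_le {F : Measure ℝ} {γ : ℝ} {α β : ℕ → ℝ}
    (h : IsEVNormalization F γ α β) {s t : ℝ} (hs : 0 < s) (hst : s < t) :
    ∀ᶠ n : ℕ in atTop, quantile F (1 - t / n) ≤ (α n * evQuantile γ s + β n : ℝ) := by
  filter_upwards [(tendsto_one_sub_div_pow t).eventually_lt (h.2 s hs)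
    (Real.exp_lt_exp.2 (neg_lt_neg hst)), eventually_div_natCast_lt_one t] with n hn h1
  have hlt : 1 - t / n < cdf F (α n * evQuantile γ s + β n) :=
    lt_of_pow_lt_pow_left₀ n (cdf_nonneg F _) hn
  exact quantile_le hlt.le ((sub_pos.2 h1).trans hlt)

lemma IsEVNormalization.eventually_le_quantile {F : Measure ℝ} {γ : ℝ} {α β : ℕ → ℝ}
    (h : IsEVNormalization F γ α β) {s t : ℝ} (ht : 0 < t) (hst : s < t) :
    ∀ᶠ n : ℕ in atTop, ((α n * evQuantile γ t + β n : ℝ) : EReal) ≤ quantile F (1 - s / n) := by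
  filter_upwards [(h.2 t ht).eventually_lt (tendsto_one_sub_div_pow s)
    (Real.exp_lt_exp.2 (neg_lt_neg hst)), eventually_div_natCast_lt_one s] with n hn h1
  exact le_quantile (lt_of_pow_lt_pow_left₀ n (sub_pos.2 h1).le hn)

/-- Quantile increments at levels `1 - t / n` are of the order of the scale `α n`, with a small
constant for close levels. -/
lemma IsEVNormalization.exists_quantile_increment_le {F : Measure ℝ} {γ : ℝ} {α β : ℕ → ℝ}
    (h : IsEVNormalization F γ α β) {t η : ℝ} (ht : 0 < t) (hη : 0 < η) :
    ∃ δ, 0 < δ ∧ δ < t ∧ ∀ᶠ n : ℕ in atTop,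
      ∃ q₁ q₂ q₃ : ℝ, quantile F (1 - (t - δ) / n) = q₁ ∧ quantile F (1 - t / n) = q₂ ∧
        quantile F (1 - (t + δ) / n) = q₃ ∧ q₁ - q₂ ≤ η * α n ∧ q₂ - q₃ ≤ η * α n := by
  obtain ⟨ρ, hρ, hball⟩ := Metric.continuousAt_iff.1 (continuousAt_evQuantile γ ht) (η / 2)
    (half_pos hη)
  obtain ⟨ξ, hξ0, hξ⟩ := exists_between (lt_min hρ ht)
  have hξρ := hξ.trans_le (min_le_left _ _)
  have hξt := hξ.trans_le (min_le_right _ _)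
  have hlo := hball (x := t - ξ) (by rw [Real.dist_eq, abs_lt]; constructor <;> linarith)
  have hhi := hball (x := t + ξ) (by rw [Real.dist_eq, abs_lt]; constructor <;> linarith)
  rw [Real.dist_eq, abs_lt] at hlo hhi
  -- Only half of `ξ` is used: the quantile comparisons need strict room between `t ± ξ / 2` and `t
  -- ± ξ`.
  refine ⟨ξ / 2, by linarith, by linarith, ?_⟩
  filter_upwards [h.eventually_quantile_le (s := t - ξ) (t := t - ξ / 2) (by linarith)
    (by linarith), h.eventually_le_quantile (s := t + ξ / 2) (t := t + ξ) (by linarith)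
    (by linarith), eventually_div_natCast_lt_one (t - ξ / 2), eventually_div_natCast_lt_one t,
    eventually_div_natCast_lt_one (t + ξ / 2), eventually_gt_atTop 0] with n h1 h3 l1 l2 l3 hn
  have hn' : (0 : ℝ) < n := Nat.cast_pos.2 hn
  obtain ⟨q₁, e₁⟩ := exists_quantile_eq_coe F (v := 1 - (t - ξ / 2) / n) (by linarith)
    (by have : 0 < (t - ξ / 2) / n := div_pos (by linarith) hn'
        linarith)
  obtain ⟨q₂, e₂⟩ := exists_quantile_eq_coe F (v := 1 - t / n) (by linarith)
    (by have : 0 < t / n := div_pos (by linarith) hn'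
        linarith)
  obtain ⟨q₃, e₃⟩ := exists_quantile_eq_coe F (v := 1 - (t + ξ / 2) / n) (by linarith)
    (by have : 0 < (t + ξ / 2) / n := div_pos (by linarith) hn'
        linarith)
  have m12 : quantile F (1 - t / n) ≤ quantile F (1 - (t - ξ / 2) / n) :=
    quantile_mono F (by gcongr; linarith)
  have m23 : quantile F (1 - (t + ξ / 2) / n) ≤ quantile F (1 - t / n) :=
    quantile_mono F (by gcongr; linarith)
  rw [e₁] at h1 m12
  rw [e₂] at m12 m23
  rw [e₃] at h3 m23
  rw [EReal.coe_le_coe_iff] at h1 h3 m12 m23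
  have hα := h.1 n
  have key : α n * evQuantile γ (t - ξ) - α n * evQuantile γ (t + ξ) ≤ η * α n := by
    rw [← mul_sub, mul_comm]
    exact mul_le_mul_of_nonneg_right (by linarith) hα.le
  exact ⟨q₁, q₂, q₃, e₁, e₂, e₃, by linarith, by linarith⟩

/-! ### Polynomial growth of the scale -/

/-- The scale at least multiplies by `2 ^ γ'` when the sample size doubles, for `γ' < γ`. -/
lemma IsEVNormalization.eventually_mul_scale_half_le {F : Measure ℝ} {γ γ' : ℝ} {α β : ℕ → ℝ}
    (h : IsEVNormalization F γ α β) (hγ : γ' < γ) :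
    ∀ᶠ n : ℕ in atTop, (2 : ℝ) ^ γ' * α (n / 2) ≤ α n := by
  have hD : 0 < evQuantile γ 1 - evQuantile γ 2 := sub_pos.2 (evQuantile_lt one_pos one_lt_two)
  -- The margin `e` supplies the strict inequalities needed to order the points; at `e = 0` the
  -- bound is strict because `2 ^ (γ' - γ) < 1`, and continuity preserves it for small `e > 0`.
  have hlim : Tendsto (fun e : ℝ => (2 : ℝ) ^ γ' * (evQuantile γ (2 - e) - evQuantile γ (4 + e)))
      (𝓝 0) (𝓝 ((2 : ℝ) ^ γ' * (evQuantile γ 2 - evQuantile γ 4))) := by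
    refine Tendsto.const_mul _ (Tendsto.sub ?_ ?_)
    · refine (continuousAt_evQuantile γ two_pos).tendsto.comp ?_
      exact Continuous.tendsto' (by fun_prop) _ _ (by norm_num)
    · refine (continuousAt_evQuantile γ four_pos).tendsto.comp ?_
      exact Continuous.tendsto' (by fun_prop) _ _ (by norm_num)
  have hlt : (2 : ℝ) ^ γ' * (evQuantile γ 2 - evQuantile γ 4) <
      evQuantile γ 1 - evQuantile γ 2 := by
    have := evQuantile_mul_sub γ two_pos one_pos two_pos
    norm_num at this
    rw [this, ← mul_assoc, ← Real.rpow_add two_pos]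
    refine mul_lt_of_lt_one_left hD ?_
    exact Real.rpow_lt_one_of_one_lt_of_neg one_lt_two (by linarith)
  obtain ⟨e, ⟨he, he1⟩, he0⟩ := (((((tendsto_order.1 hlim).2 _ hlt).filter_mono
    nhdsWithin_le_nhds).and (nhdsWithin_le_nhds (Iio_mem_nhds one_pos))).and
    (self_mem_nhdsWithin (a := (0 : ℝ)) (s := Set.Ioi 0))).exists
  replace he1 : e < 1 := he1
  replace he0 : 0 < e := he0
  have hhalf : Tendsto (fun n : ℕ => n / 2) atTop atTop := Nat.tendsto_div_const_atTop two_ne_zero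
  -- The point with parameter `t` in the normalization at `n / 2` plays the role of `2 * t` at `n`.
  -- The floor is harmless since `n / ⌊n / 2⌋ → 2`.
  have hpow : ∀ t, 0 < t → Tendsto
      (fun n : ℕ => cdf F (α (n / 2) * evQuantile γ t + β (n / 2)) ^ n) atTop
      (𝓝 (Real.exp (-(2 * t)))) := by
    intro t ht
    have h1 := (h.2 t ht).comp hhalf
    have hquot : Tendsto (fun n : ℕ => (n : ℝ) / (n / 2 : ℕ)) atTop (𝓝 2) := by
      have h2 : Tendsto (fun n : ℕ => ((n / 2 : ℕ) : ℝ) / n) atTop (𝓝 (1 / 2)) := by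
        have := (tendsto_nat_floor_div_atTop (R := ℝ)).comp
          (tendsto_natCast_atTop_atTop.atTop_div_const (two_pos : (0 : ℝ) < 2))
        refine ((this.div_const 2).congr fun n => ?_)
        have e : ⌊(n : ℝ) / 2⌋₊ = n / 2 := by
          have := Nat.floor_div_natCast (K := ℝ) (n : ℝ) 2
          simpa using this
        simp only [Function.comp_apply, e]
        rw [div_div, div_mul_cancel₀ _ two_ne_zero]
      have := h2.inv₀ (by norm_num)
      simpa using this
    have h3 := h1.rpow hquot (Or.inl (Real.exp_pos _).ne')
    have e : Real.exp (-t) ^ (2 : ℝ) = Real.exp (-(2 * t)) := by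
      rw [← Real.exp_mul]
      ring_nf
    rw [e] at h3
    refine h3.congr' ?_
    filter_upwards [eventually_ge_atTop 2] with n hn
    have hm : ((n / 2 : ℕ) : ℝ) ≠ 0 := Nat.cast_ne_zero.2 (by omega)
    simp only [Function.comp_apply]
    rw [← Real.rpow_natCast _ (n / 2), ← Real.rpow_mul (cdf_nonneg F _), mul_div_cancel₀ _ hm,
      Real.rpow_natCast]
  have c1 := eventually_lt_of_tendsto_pow_cdf (hpow 1 one_pos) (h.2 (2 - e) (by linarith))
    (Real.exp_lt_exp.2 (by linarith))
  have c2 := eventually_lt_of_tendsto_pow_cdf (h.2 (4 + e) (by linarith)) (hpow 2 two_pos)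
    (Real.exp_lt_exp.2 (by linarith))
  filter_upwards [c1, c2] with n h1 h2
  have h3 : α (n / 2) * (evQuantile γ 1 - evQuantile γ 2) ≤
      α n * (evQuantile γ (2 - e) - evQuantile γ (4 + e)) := by linarith
  have hr : (0 : ℝ) < 2 ^ γ' := Real.rpow_pos_of_pos two_pos _
  refine le_of_mul_le_mul_right ?_ hD
  calc (2 : ℝ) ^ γ' * α (n / 2) * (evQuantile γ 1 - evQuantile γ 2)
      = 2 ^ γ' * (α (n / 2) * (evQuantile γ 1 - evQuantile γ 2)) := by ring
    _ ≤ 2 ^ γ' * (α n * (evQuantile γ (2 - e) - evQuantile γ (4 + e))) := by gcongr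
    _ = α n * (2 ^ γ' * (evQuantile γ (2 - e) - evQuantile γ (4 + e))) := by ring
    _ ≤ α n * (evQuantile γ 1 - evQuantile γ 2) :=
        mul_le_mul_of_nonneg_left he.le (h.1 n).le

/-- Halving `n` down to a finite base range costs one factor `2 ^ γ'` per step, about `log₂ n` steps
in all, and `2 ^ Nat.log 2 n` lies in `[n / 2, n]`. -/
lemma exists_rpow_le_of_mul_half_le {α : ℕ → ℝ} (hα : ∀ n, 0 < α n) {γ' : ℝ}
    (h : ∀ᶠ n : ℕ in atTop, (2 : ℝ) ^ γ' * α (n / 2) ≤ α n) :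
    ∃ c, 0 < c ∧ ∀ᶠ n : ℕ in atTop, c * (n : ℝ) ^ γ' ≤ α n := by
  obtain ⟨m, hm⟩ := eventually_atTop.1 h
  have hr : (0 : ℝ) < 2 ^ γ' := Real.rpow_pos_of_pos two_pos _
  -- The bound `m + 2` ensures that outside the range both `n ≥ m` and `n ≥ 2` hold, the latter for
  -- the recursion of `Nat.log`.
  obtain ⟨c, hc, hbase⟩ : ∃ c, 0 < c ∧ ∀ n ∈ Finset.range (m + 2),
      c * ((2 : ℝ) ^ γ') ^ Nat.log 2 n ≤ α n := by
    let g : ℕ → ℝ := fun n => α n / ((2 : ℝ) ^ γ') ^ Nat.log 2 n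
    obtain ⟨k, -, hk⟩ := (Finset.range (m + 2)).exists_min_image g ⟨0, by simp⟩
    exact ⟨g k, div_pos (hα k) (pow_pos hr _), fun n hn =>
      (le_div_iff₀ (pow_pos hr _)).1 (hk n hn)⟩
  have hlog : ∀ n, c * ((2 : ℝ) ^ γ') ^ Nat.log 2 n ≤ α n := by
    intro n
    induction n using Nat.strong_induction_on with
    | _ n ih =>
      by_cases hn : n < m + 2
      · exact hbase n (Finset.mem_range.2 hn)
      · have e : Nat.log 2 n = Nat.log 2 (n / 2) + 1 := Nat.log_of_one_lt_of_le one_lt_two (by omega)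
        calc c * ((2 : ℝ) ^ γ') ^ Nat.log 2 n
            = 2 ^ γ' * (c * ((2 : ℝ) ^ γ') ^ Nat.log 2 (n / 2)) := by rw [e, pow_succ]; ring
          _ ≤ 2 ^ γ' * α (n / 2) := by
              have := ih (n / 2) (by omega)
              gcongr
          _ ≤ α n := hm n (by omega)
  -- The minimum covers both signs of `γ'`: the lower bound `n / 2` is used if `γ' ≥ 0`, the upper
  -- bound `n` otherwise.
  refine ⟨c * min 1 ((2 : ℝ) ^ (-γ')), mul_pos hc (lt_min one_pos (Real.rpow_pos_of_pos two_pos _)),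
    ?_⟩
  filter_upwards [eventually_gt_atTop 0] with n hn
  refine le_trans ?_ (hlog n)
  rw [mul_assoc]
  refine mul_le_mul_of_nonneg_left ?_ hc.le
  have hn' : (0 : ℝ) < n := Nat.cast_pos.2 hn
  have e : ((2 : ℝ) ^ γ') ^ Nat.log 2 n = ((2 : ℝ) ^ Nat.log 2 n) ^ γ' := by
    rw [← Real.rpow_natCast, ← Real.rpow_natCast, ← Real.rpow_mul two_pos.le,
      ← Real.rpow_mul two_pos.le, mul_comm]
  rw [e]
  have hle : (2 : ℝ) ^ Nat.log 2 n ≤ n := by exact_mod_cast Nat.pow_log_le_self 2 hn.ne'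
  have hge : (n : ℝ) / 2 ≤ (2 : ℝ) ^ Nat.log 2 n := by
    rw [div_le_iff₀ two_pos, ← pow_succ]
    exact_mod_cast (Nat.lt_pow_succ_log_self one_lt_two n).le
  rcases le_total 0 γ' with h0 | h0
  · calc min 1 ((2 : ℝ) ^ (-γ')) * (n : ℝ) ^ γ' ≤ 2 ^ (-γ') * (n : ℝ) ^ γ' := by
          gcongr
          exact min_le_right _ _
      _ = ((n : ℝ) / 2) ^ γ' := by
          rw [Real.div_rpow hn'.le two_pos.le, Real.rpow_neg two_pos.le]
          ring
      _ ≤ _ := Real.rpow_le_rpow (by positivity) hge h0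
  · calc min 1 ((2 : ℝ) ^ (-γ')) * (n : ℝ) ^ γ' ≤ 1 * (n : ℝ) ^ γ' := by
          gcongr
          exact min_le_left _ _
      _ = (n : ℝ) ^ γ' := one_mul _
      _ ≤ _ := Real.rpow_le_rpow_of_nonpos (by positivity) hle h0

lemma IsEVNormalization.exists_rpow_le_scale {F : Measure ℝ} {γ γ' : ℝ} {α β : ℕ → ℝ}
    (h : IsEVNormalization F γ α β) (hγ : γ' < γ) :
    ∃ c, 0 < c ∧ ∀ᶠ n : ℕ in atTop, c * (n : ℝ) ^ γ' ≤ α n :=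
  exists_rpow_le_of_mul_half_le h.1 (h.eventually_mul_scale_half_le hγ)

/-! ### Normalizations of the sample maximum -/

lemma MeasureTheory.IsTightMeasureSet.exists_measure_abs_ge_lt {S : Set (Measure ℝ)} (h : IsTightMeasureSet S)
    {η : ENNReal} (hη : 0 < η) : ∃ R : ℝ, 0 < R ∧ ∀ μ ∈ S, μ {x | R ≤ |x|} < η := by
  obtain ⟨η', hη'0, hη'⟩ := exists_between hη
  obtain ⟨K, hK, hS⟩ := isTightMeasureSet_iff_exists_isCompact_measure_compl_le.1 h η' hη'0
  obtain ⟨R, hR⟩ := hK.isBounded.exists_norm_le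
  refine ⟨|R| + 1, by positivity, fun μ hμ => (measure_mono ?_).trans_lt ((hS μ hμ).trans_lt hη')⟩
  intro x hx hxK
  have h1 : |x| ≤ R := hR x hxK
  have h2 : |R| + 1 ≤ |x| := hx
  linarith [le_abs_self R]

lemma measureReal_sampleMax_le {Ω : Type*} [MeasurableSpace Ω] {P : Measure Ω}
    [IsProbabilityMeasure P] {θ : ℕ → Ω → ℝ} {F : Measure ℝ} [IsProbabilityMeasure F]
    (hlaw : ∀ i, HasLaw (θ i) F P) (hind : iIndepFun θ P) {n : ℕ} (hn : 0 < n) (x : ℝ) :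
    P.real {ω | sampleMax θ n ω ≤ x} = cdf F x ^ n := by
  have : NeZero n := ⟨hn.ne'⟩
  have e : {ω | sampleMax θ n ω ≤ x} = ⋂ i ∈ Finset.range n, θ i ⁻¹' Set.Iic x := by
    ext ω
    simp only [sampleMax, Set.mem_ofPred_eq, Set.mem_iInter, Finset.mem_range, Set.mem_preimage,
      Set.mem_Iic]
    rw [ciSup_le_iff (Set.finite_range _).bddAbove]
    exact ⟨fun h i hi => h ⟨i, hi⟩, fun h i => h i i.2⟩
  rw [e, measureReal_def, hind.measure_inter_preimage_eq_mul (Finset.range n)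
    (sets := fun _ => Set.Iic x) (fun _ _ => measurableSet_Iic), ENNReal.toReal_prod]
  have h1 : ∀ i, (P (θ i ⁻¹' Set.Iic x)).toReal = cdf F x := fun i => by
    rw [cdf_eq_real]
    exact (hlaw i).measureReal_eq (p := fun z => z ≤ x) measurableSet_Iic
  simp [h1]

/-- Any normalization for which the maxima are tight is at least of the order of the scale of an
extreme value normalization. -/
lemma IsEVNormalization.exists_scale_le {Ω : Type*} [MeasurableSpace Ω] {P : Measure Ω}
    [IsProbabilityMeasure P] {Ω' : Type*} [MeasurableSpace Ω'] {P' : Measure Ω'}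
    [IsProbabilityMeasure P'] {θ : ℕ → Ω → ℝ} {F : Measure ℝ} [IsProbabilityMeasure F]
    (hlaw : ∀ i, HasLaw (θ i) F P) (hind : iIndepFun θ P) {γ : ℝ} {α β : ℕ → ℝ}
    (h : IsEVNormalization F γ α β) {a b : ℕ → ℝ} (ha : ∀ᶠ n in atTop, 0 < a n) {X : Ω' → ℝ}
    (hconv : TendstoInDistribution (fun n ω => (sampleMax θ n ω - b n) / a n) atTop X
      (fun _ => P) P') :
    ∃ c, 0 < c ∧ ∀ᶠ n in atTop, c * α n ≤ a n := by
  have : IsProbabilityMeasure (P'.map X) := Measure.isProbabilityMeasure_map hconv.aemeasurable_limit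
  -- The level `1 / 10` is below both `exp (-2)` and `1 - exp (-1)`, the limiting probabilities that
  -- the maximum lies below the point with parameter `2` and above the point with parameter `1`.
  -- Both points must then lie within `K * a n` of `b n` on the relevant side.
  obtain ⟨K, hK, hKX⟩ := (isTightMeasureSet_singleton (μ := P'.map X)).exists_measure_abs_ge_lt
    (η := ENNReal.ofReal (1 / 10)) (by simp)
  have hclosed : IsClosed {x : ℝ | K ≤ |x|} := isClosed_le continuous_const continuous_abs
  have hlim := (ProbabilityMeasure.limsup_measure_closed_le_of_tendsto hconv.tendsto
    hclosed).trans_lt (hKX _ rfl)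
  have hev := eventually_lt_of_limsup_lt hlim
  have hD : 0 < evQuantile γ 1 - evQuantile γ 2 := sub_pos.2 (evQuantile_lt one_pos one_lt_two)
  refine ⟨(evQuantile γ 1 - evQuantile γ 2) / (2 * K), by positivity, ?_⟩
  have e2 : (1 / 10 : ℝ) < Real.exp (-2) := by
    rw [Real.exp_neg, show (2 : ℝ) = 1 + 1 by norm_num, Real.exp_add, one_div]
    refine inv_strictAnti₀ (by positivity) ?_
    nlinarith [Real.exp_one_lt_d9, Real.exp_pos 1]
  have e1 : Real.exp (-1) < (9 / 10 : ℝ) := by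
    rw [Real.exp_neg, inv_lt_comm₀ (Real.exp_pos _) (by norm_num)]
    linarith [Real.exp_one_gt_d9]
  filter_upwards [hev, ha, eventually_gt_atTop 0, (tendsto_order.1 (h.2 2 two_pos)).1 _ e2,
    (tendsto_order.1 (h.2 1 one_pos)).2 _ e1] with n hn han hn0 h2 h1
  rw [← measureReal_sampleMax_le hlaw hind hn0] at h1 h2
  have hmap : (P.map fun ω => (sampleMax θ n ω - b n) / a n) {x | K ≤ |x|} =
      P {ω | K ≤ |(sampleMax θ n ω - b n) / a n|} :=
    Measure.map_apply_of_aemeasurable (hconv.forall_aemeasurable n) hclosed.measurableSet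
  have hA : P.real {ω | K ≤ |(sampleMax θ n ω - b n) / a n|} < 1 / 10 := by
    refine (ENNReal.toReal_lt_of_lt_ofReal ?_)
    rw [← hmap]
    exact hn
  have c1 : b n - K * a n < α n * evQuantile γ 2 + β n := by
    by_contra! hle
    refine absurd (h2.trans_le (measureReal_mono fun ω hω => ?_)) hA.not_gt
    have hω' : sampleMax θ n ω ≤ α n * evQuantile γ 2 + β n := hω
    change K ≤ |(sampleMax θ n ω - b n) / a n|
    refine le_trans ?_ (neg_le_abs _)
    rw [← neg_div, le_div_iff₀ han]
    linarith
  have c2 : α n * evQuantile γ 1 + β n < b n + K * a n := by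
    by_contra! hle
    have hcover : (Set.univ : Set Ω) ⊆ {ω | sampleMax θ n ω ≤ α n * evQuantile γ 1 + β n} ∪
        {ω | K ≤ |(sampleMax θ n ω - b n) / a n|} := fun ω _ => by
      by_cases hω : sampleMax θ n ω ≤ α n * evQuantile γ 1 + β n
      · exact Or.inl hω
      · refine Or.inr (show K ≤ |(sampleMax θ n ω - b n) / a n| from
          le_trans ?_ (le_abs_self _))
        rw [le_div_iff₀ han]
        linarith
    have := (measureReal_mono (μ := P) hcover).trans (measureReal_union_le _ _)
    rw [probReal_univ] at this
    linarith
  rw [div_mul_eq_mul_div, div_le_iff₀ (by positivity)]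
  linarith

/-! ### Tails of the noise -/

/-- Up to constants, `h n` dominates the quantiles of all the laws `G T`, `T ≥ 1`, at the levels
`δ / n` and `1 - δ / n`. -/
def HasTailScale (G : ℕ → Measure ℝ) (h : ℕ → ℝ) : Prop :=
  ∀ δ : ℝ, 0 < δ → ∃ C : ℝ, 0 < C ∧ ∀ᶠ n : ℕ in atTop, ∀ T, 0 < T →
    (G T).real {x | C * h n ≤ |x|} < δ / n

lemma HasTailScale.of_moment {G : ℕ → Measure ℝ} {S : ENNReal} (hS : S ≠ ⊤) {β : ℝ} (hβ : 0 < β)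
    (hG : ∀ T, 0 < T → ∫⁻ x, ‖x‖ₑ ^ β ∂(G T) ≤ S) :
    HasTailScale G fun n => (n : ℝ) ^ (1 / β) := by
  intro δ hδ
  have hpos : 0 < (S.toReal + 1) / δ := by positivity
  -- Chosen so that Markov's inequality gives `S * δ / ((S + 1) * n)`; the `+ 1` makes the bound
  -- strict.
  refine ⟨((S.toReal + 1) / δ) ^ (1 / β), by positivity, ?_⟩
  filter_upwards [eventually_gt_atTop 0] with n hn T hT
  have hn' : (0 : ℝ) < n := Nat.cast_pos.2 hn
  set K : ℝ := ((S.toReal + 1) / δ) ^ (1 / β) * (n : ℝ) ^ (1 / β) with hKdef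
  have hK0 : 0 < K := by positivity
  have hKβ : K ^ β = (S.toReal + 1) / δ * n := by
    rw [hKdef, ← Real.mul_rpow hpos.le hn'.le, ← Real.rpow_mul (by positivity),
      one_div_mul_cancel hβ.ne', Real.rpow_one]
  have hsub : {x : ℝ | K ≤ |x|} ⊆ {x : ℝ | ENNReal.ofReal (K ^ β) ≤ ‖x‖ₑ ^ β} := fun x hx => by
    simp only [Set.mem_ofPred_eq] at hx ⊢
    rw [← ENNReal.ofReal_rpow_of_pos hK0, Real.enorm_eq_ofReal_abs]
    exact ENNReal.rpow_le_rpow (ENNReal.ofReal_le_ofReal hx) hβ.le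
  have hmark := (mul_meas_ge_le_lintegral₀ (μ := G T) (f := fun x : ℝ => ‖x‖ₑ ^ β)
    (by fun_prop) (ENNReal.ofReal (K ^ β))).trans (hG T hT)
  have h2 : ENNReal.ofReal (K ^ β) * G T {x | K ≤ |x|} ≤ S :=
    le_trans (by gcongr) hmark
  have h3 := ENNReal.toReal_mono hS h2
  rw [ENNReal.toReal_mul, ENNReal.toReal_ofReal (by positivity), hKβ] at h3
  rw [lt_div_iff₀ hn', measureReal_def]
  have h4 : (S.toReal + 1) / δ * n * (G T {x | K ≤ |x|}).toReal * δ =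
      (S.toReal + 1) * ((G T {x | K ≤ |x|}).toReal * n) := by
    field_simp
  have h5 : (S.toReal + 1) * ((G T {x | K ≤ |x|}).toReal * n) < (S.toReal + 1) * δ := by
    rw [← h4]
    have : S.toReal * δ < (S.toReal + 1) * δ := by linarith
    exact lt_of_le_of_lt (mul_le_mul_of_nonneg_right h3 hδ.le) this
  exact lt_of_mul_lt_mul_left h5 (by positivity)

/-- Allowing a proxy `V ≥ v` makes the tail bound uniform over all variances up to `V`, including `v
= 0`. -/
lemma hasSubgaussianMGF_sub_gaussianReal (m : ℝ) {v V : NNReal} (hv : v ≤ V) :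
    HasSubgaussianMGF (fun x => x - m) V (gaussianReal m v) := by
  have hmap : (gaussianReal m v).map (fun x => x - m) = gaussianReal 0 v := by
    rw [gaussianReal_map_sub_const, sub_self]
  refine ⟨fun t => ?_, fun t => ?_⟩
  · have h := integrable_exp_mul_gaussianReal (μ := 0) (v := v) t
    rw [← hmap, integrable_map_measure (by fun_prop) (by fun_prop)] at h
    exact h
  · rw [mgf_gaussianReal hmap, zero_mul, zero_add]
    gcongr

lemma gaussianReal_measureReal_abs_sub_ge_le (m : ℝ) {v V : NNReal} (hv : v ≤ V) {t : ℝ}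
    (ht : 0 ≤ t) :
    (gaussianReal m v).real {x | t ≤ |x - m|} ≤ 2 * Real.exp (-t ^ 2 / (2 * V)) := by
  have hs := hasSubgaussianMGF_sub_gaussianReal m hv
  have h1 := hs.measure_ge_le ht
  have h2 := hs.neg.measure_ge_le ht
  have hsub : {x : ℝ | t ≤ |x - m|} ⊆ {x | t ≤ x - m} ∪ {x | t ≤ (-fun x => x - m) x} :=
    fun x (hx : t ≤ |x - m|) => (le_abs.1 hx : t ≤ x - m ∨ t ≤ -(x - m))
  have := (measureReal_mono (μ := gaussianReal m v) hsub).trans (measureReal_union_le _ _)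
  linarith

/-- The density is at most `1 / √(2πv)`, so a large variance cannot leave half of the mass in an
interval of length `2 * R`. -/
lemma variance_le_of_gaussianReal_measureReal_abs_ge_lt {m R : ℝ} {v : NNReal} (hR : 0 < R)
    (h : (gaussianReal m v).real {x | R ≤ |x|} < 1 / 2) : (v : ℝ) ≤ 16 * R ^ 2 := by
  rcases eq_or_ne v 0 with rfl | hv
  · simp only [NNReal.coe_zero]
    positivity
  have hv' : (0 : ℝ) < v := NNReal.coe_pos.2 (pos_iff_ne_zero.2 hv)
  have hcover : (Set.univ : Set ℝ) ⊆ {x | R ≤ |x|} ∪ Set.Icc (-R) R := fun x _ => by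
    by_cases hx : R ≤ |x|
    · exact Or.inl hx
    · exact Or.inr (abs_le.1 (not_le.1 hx).le)
  have h1 := (measureReal_mono (μ := gaussianReal m v) hcover).trans (measureReal_union_le _ _)
  rw [probReal_univ] at h1
  have h2 : gaussianReal m v (Set.Icc (-R) R) ≤
      ENNReal.ofReal ((√(2 * Real.pi * v))⁻¹) * ENNReal.ofReal (2 * R) := by
    rw [gaussianReal_apply m hv]
    calc ∫⁻ x in Set.Icc (-R) R, gaussianPDF m v x
        ≤ ∫⁻ _ in Set.Icc (-R) R, ENNReal.ofReal ((√(2 * Real.pi * v))⁻¹) := by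
          refine lintegral_mono fun x => ENNReal.ofReal_le_ofReal ?_
          rw [gaussianPDFReal_def]
          refine mul_le_of_le_one_right (by positivity) (Real.exp_le_one_iff.2 ?_)
          exact div_nonpos_of_nonpos_of_nonneg (neg_nonpos.2 (sq_nonneg _)) (by positivity)
      _ = _ := by
          rw [setLIntegral_const, Real.volume_Icc]
          congr 2
          ring
  have h3 := ENNReal.toReal_mono (ENNReal.mul_ne_top ENNReal.ofReal_ne_top
    ENNReal.ofReal_ne_top) h2
  rw [ENNReal.toReal_mul, ENNReal.toReal_ofReal (by positivity),
    ENNReal.toReal_ofReal (by positivity), ← measureReal_def] at h3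
  have hs : 0 < √(2 * Real.pi * v) := Real.sqrt_pos.2 (by positivity)
  have h4 : 1 / 2 < (√(2 * Real.pi * v))⁻¹ * (2 * R) := by linarith
  rw [← div_eq_inv_mul, lt_div_iff₀ hs] at h4
  have h5 : 2 * Real.pi * v < (4 * R) ^ 2 := by
    rw [← Real.sqrt_lt' (by positivity)]
    linarith
  nlinarith [Real.pi_gt_three]

/-- More than half of the mass lies in `(-R, R)`, and by concentration more than half lies within
`12 * R` of `m`, so the two sets meet. -/
lemma abs_mean_le_of_gaussianReal_measureReal_abs_ge_lt {m R : ℝ} {v : NNReal} (hR : 0 < R)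
    (h : (gaussianReal m v).real {x | R ≤ |x|} < 1 / 2) : |m| ≤ 13 * R := by
  have hv := variance_le_of_gaussianReal_measureReal_abs_ge_lt hR h
  have hV := gaussianReal_measureReal_abs_sub_ge_le m
    (show v ≤ (⟨16 * R ^ 2, by positivity⟩ : NNReal) from hv) (t := 12 * R) (by positivity)
  have he : -(12 * R) ^ 2 / (2 * (16 * R ^ 2)) = -(9 / 2 : ℝ) := by
    field_simp
    norm_num
  replace hV := hV.trans_eq (congrArg (fun z => 2 * Real.exp z) he)
  have hexp : Real.exp (-(9 / 2)) < 1 / 4 := by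
    rw [Real.exp_neg, inv_lt_comm₀ (Real.exp_pos _) (by norm_num)]
    linarith [Real.add_one_le_exp (9 / 2 : ℝ)]
  by_contra! hm
  have hcover : (Set.univ : Set ℝ) ⊆ {x | R ≤ |x|} ∪ {x | 12 * R ≤ |x - m|} := fun x _ => by
    by_cases hx : R ≤ |x|
    · exact Or.inl hx
    · refine Or.inr ?_
      have h1 := abs_sub_abs_le_abs_sub m x
      rw [abs_sub_comm] at h1
      simp only [Set.mem_ofPred_eq]
      linarith
  have h1 := (measureReal_mono (μ := gaussianReal m v) hcover).trans (measureReal_union_le _ _)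
  rw [probReal_univ] at h1
  linarith

lemma HasTailScale.of_gaussian {G : ℕ → Measure ℝ} (htight : IsTightMeasureSet (G '' Set.Ioi 0))
    (hG : ∀ T, 0 < T → ∃ (m : ℝ) (v : NNReal), G T = gaussianReal m v) :
    HasTailScale G fun n => √(Real.log n) := by
  intro δ hδ
  obtain ⟨R, hR, hRG⟩ := htight.exists_measure_abs_ge_lt (η := ENNReal.ofReal (1 / 2)) (by simp)
  -- Half of the constant absorbs the mean, as `|m| ≤ 13 * R ≤ 8 * R * √(log n)` once `log n ≥ 4`;
  -- the other half, with variance at most `16 * R ^ 2`, gives the tail `2 / n ^ 2`.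
  refine ⟨16 * R, by positivity, ?_⟩
  have hlog : Tendsto (fun n : ℕ => Real.log n) atTop atTop :=
    Real.tendsto_log_atTop.comp tendsto_natCast_atTop_atTop
  filter_upwards [hlog.eventually_ge_atTop 4, eventually_gt_atTop 0,
    tendsto_natCast_atTop_atTop.eventually_gt_atTop (2 / δ)] with n hn4 hn hnδ T hT
  have hn' : (0 : ℝ) < n := Nat.cast_pos.2 hn
  obtain ⟨m, v, hmv⟩ := hG T hT
  have hlt : (gaussianReal m v).real {x | R ≤ |x|} < 1 / 2 := by
    rw [← hmv]
    exact ENNReal.toReal_lt_of_lt_ofReal (hRG _ ⟨T, hT, rfl⟩)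
  have hm := abs_mean_le_of_gaussianReal_measureReal_abs_ge_lt hR hlt
  have hv := variance_le_of_gaussianReal_measureReal_abs_ge_lt hR hlt
  have hsq : 2 ≤ √(Real.log n) := Real.le_sqrt_of_sq_le (by linarith)
  have hV := gaussianReal_measureReal_abs_sub_ge_le m
    (show v ≤ (⟨16 * R ^ 2, by positivity⟩ : NNReal) from hv) (t := 8 * R * √(Real.log n))
    (by positivity)
  have he : -(8 * R * √(Real.log n)) ^ 2 / (2 * (16 * R ^ 2)) = -(2 * Real.log n) := by
    rw [mul_pow, Real.sq_sqrt (by linarith)]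
    field_simp
    norm_num
  replace hV := hV.trans_eq (congrArg (fun z => 2 * Real.exp z) he)
  have hexp : Real.exp (-(2 * Real.log n)) = 1 / (n * n) := by
    rw [Real.exp_neg, two_mul, Real.exp_add, Real.exp_log hn', one_div]
  rw [hexp] at hV
  rw [hmv]
  calc (gaussianReal m v).real {x | 16 * R * √(Real.log n) ≤ |x|}
      ≤ (gaussianReal m v).real {x | 8 * R * √(Real.log n) ≤ |x - m|} := by
        refine measureReal_mono fun x hx => ?_
        simp only [Set.mem_ofPred_eq] at hx ⊢
        have h1 := abs_sub_abs_le_abs_sub x m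
        nlinarith
    _ ≤ 2 * (1 / (n * n)) := hV
    _ < δ / n := by
        rw [div_lt_iff₀ hδ] at hnδ
        rw [lt_div_iff₀ hn']
        have : 2 * (1 / ((n : ℝ) * n)) * n = 2 / n := by field_simp
        rw [this, div_lt_iff₀ hn']
        linarith

/-! ### Tail equivalence -/

lemma tendsto_zero_of_forall_eventually_abs_le {ι : Type*} {l : Filter ι} {f : ι → EReal}
    (h : ∀ e : ℝ, 0 < e → ∀ᶠ q in l, ((-e : ℝ) : EReal) ≤ f q ∧ f q ≤ (e : ℝ)) :
    Tendsto f l (𝓝 0) := by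
  refine tendsto_order.2 ⟨fun x hx => ?_, fun x hx => ?_⟩
  · obtain ⟨r, h1, h2⟩ := EReal.lt_iff_exists_real_btwn.1 hx
    filter_upwards [h (-r) (neg_pos.2 (by exact_mod_cast h2))] with q hq
    exact h1.trans_le (by simpa using hq.1)
  · obtain ⟨r, h1, h2⟩ := EReal.lt_iff_exists_real_btwn.1 hx
    filter_upwards [h r (by exact_mod_cast h1)] with q hq
    exact hq.2.trans_lt h2

/-- Bounding `x` and `g` from the same side by reals uses monotonicity alone, so infinite quantiles
need no separate treatment here or in the next lemma. -/
lemma EReal.mul_sub_add_mul_le {x g : EReal} {k q D s K : ℝ} (hk : 0 ≤ k) (hs : 0 ≤ s)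
    (hx : x ≤ (q + D : ℝ)) (hg : g ≤ K) :
    (k : EReal) * (x - q + s * g) ≤ (k * (D + s * K) : ℝ) := by
  rw [EReal.coe_mul, EReal.coe_add, EReal.coe_mul]
  refine mul_le_mul_of_nonneg_left (add_le_add ?_ (mul_le_mul_of_nonneg_left hg ?_)) ?_
  · have : x - q ≤ ((q + D : ℝ) : EReal) - q := EReal.sub_le_sub hx le_rfl
    rwa [← EReal.coe_sub, _root_.add_sub_cancel_left] at this
  · exact_mod_cast hs
  · exact_mod_cast hk

lemma EReal.le_mul_sub_add_mul {x g : EReal} {k q D s K : ℝ} (hk : 0 ≤ k) (hs : 0 ≤ s)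
    (hx : ((q + D : ℝ) : EReal) ≤ x) (hg : (K : EReal) ≤ g) :
    ((k * (D + s * K) : ℝ) : EReal) ≤ (k : EReal) * (x - q + s * g) := by
  rw [EReal.coe_mul, EReal.coe_add, EReal.coe_mul]
  refine mul_le_mul_of_nonneg_left (add_le_add ?_ (mul_le_mul_of_nonneg_left hg ?_)) ?_
  · have : ((q + D : ℝ) : EReal) - q ≤ x - q := EReal.sub_le_sub hx le_rfl
    rwa [← EReal.coe_sub, _root_.add_sub_cancel_left] at this
  · exact_mod_cast hs
  · exact_mod_cast hk

section TailEquivalence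

variable {F : Measure ℝ} {G : ℕ → Measure ℝ} {p : ℝ} {a h : ℕ → ℝ} {l : Filter (ℕ × ℕ)}

/-- Quantile increments of `F` at levels `1 - t / n` are eventually small relative to `a n` for
close levels. -/
def HasSmallQuantileIncrements (F : Measure ℝ) (a : ℕ → ℝ) : Prop :=
  ∀ t η : ℝ, 0 < t → 0 < η → ∃ δ, 0 < δ ∧ δ < t ∧ ∀ᶠ n : ℕ in atTop,
    ∃ q₁ q₂ q₃ : ℝ, quantile F (1 - (t - δ) / n) = q₁ ∧ quantile F (1 - t / n) = q₂ ∧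
      quantile F (1 - (t + δ) / n) = q₃ ∧ q₁ - q₂ ≤ η * a n ∧ q₂ - q₃ ≤ η * a n

lemma IsEVNormalization.hasSmallQuantileIncrements {γ c : ℝ} {α β : ℕ → ℝ}
    (hα : IsEVNormalization F γ α β) (hc : 0 < c) (hca : ∀ᶠ n in atTop, c * α n ≤ a n) :
    HasSmallQuantileIncrements F a := by
  intro t η ht hη
  obtain ⟨δ, hδ, hδt, hev⟩ := hα.exists_quantile_increment_le ht (mul_pos hη hc)
  refine ⟨δ, hδ, hδt, ?_⟩
  filter_upwards [hev, hca] with n hn hcn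
  obtain ⟨q₁, q₂, q₃, e₁, e₂, e₃, h1, h2⟩ := hn
  have := mul_le_mul_of_nonneg_left hcn hη.le
  exact ⟨q₁, q₂, q₃, e₁, e₂, e₃, by linarith, by linarith⟩

variable (hG : ∀ T, 0 < T → IsProbabilityMeasure (G T))
  (htight : IsTightMeasureSet (G '' Set.Ioi 0))
  (hN : Tendsto Prod.fst l atTop) (hT : Tendsto Prod.snd l atTop)
  (ha : ∀ᶠ n in atTop, 0 < a n) (hh : ∀ᶠ n in atTop, 1 ≤ h n)
  (hscale : HasTailScale G h) (hF : HasSmallQuantileIncrements F a)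
  (hrate : Tendsto (fun q : ℕ × ℕ => h q.1 / (a q.1 * (q.2 : ℝ) ^ p)) l (𝓝 0))

include hG htight hN hT ha hh hscale hF hrate

lemma teInf_of_hasTailScale : TEInf F G p a l := by
  intro τ hτ
  obtain ⟨M, hM0, hM⟩ := htight.exists_measure_abs_ge_lt (η := ENNReal.ofReal (1 / 2)) (by simp)
  refine tendsto_zero_of_forall_eventually_abs_le fun e he => ?_
  have ht : 0 < 1 / τ := by positivity
  obtain ⟨δ, hδ, hδt, hev⟩ := hF (1 / τ) (e / 2) ht (by positivity)
  obtain ⟨C, hC, hCev⟩ := hscale δ hδ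
  have hsmall : ∀ c : ℝ, ∀ r : ℝ, 0 < r → ∀ᶠ q : ℕ × ℕ in l,
      c * (h q.1 / (a q.1 * (q.2 : ℝ) ^ p)) < r := fun c r hr =>
    (tendsto_order.1 (hrate.const_mul c)).2 r (by simpa using hr)
  filter_upwards [hN.eventually hev, hN.eventually hCev, hN.eventually ha, hN.eventually hh,
    hN.eventually (eventually_gt_atTop 0), hT.eventually (eventually_gt_atTop 0),
    hN.eventually (eventually_div_natCast_lt_one δ),
    hN.eventually (eventually_div_natCast_lt_one (2 * (1 / τ))),
    hsmall C (e / 2) (by positivity), hsmall M e he]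
    with ⟨n, T⟩ hinc htail han hhn hn hT0 hδn htn hC' hM'
  simp only at hinc htail han hhn hn hT0 hδn htn hC' hM' ⊢
  have := hG T hT0
  have hn' : (0 : ℝ) < n := Nat.cast_pos.2 hn
  have hT' : (0 : ℝ) < T := Nat.cast_pos.2 hT0
  have hTp : 0 < (T : ℝ) ^ p := Real.rpow_pos_of_pos hT' p
  obtain ⟨q₁, q₂, -, e₁, e₂, -, hq, -⟩ := hinc
  have et : 1 / ((n : ℝ) * τ) = 1 / τ / n := by field_simp
  have hk : 0 ≤ 1 / a n := by positivity
  have hs : 0 ≤ 1 / (T : ℝ) ^ p := by positivity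
  rw [et, e₂]
  constructor
  · refine le_iInf₂ fun u hu => ?_
    have hMT : (G T).real {x | M ≤ |x|} < 1 / 2 :=
      ENNReal.toReal_lt_of_lt_ofReal (hM _ ⟨T, hT0, rfl⟩)
    have hu2 : u ≤ 1 / 2 := by
      have := hu.2
      rw [mul_div_assoc] at htn
      linarith
    have hg : ((-M : ℝ) : EReal) ≤ quantile (G T) (1 - u) :=
      (le_quantile_of_measure_abs_ge_lt hMT).trans (quantile_mono _ (by linarith))
    have hx : ((q₂ + 0 : ℝ) : EReal) ≤ quantile F (1 - 1 / τ / n + u) := by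
      rw [add_zero, ← e₂]
      exact quantile_mono F (by linarith [hu.1])
    refine le_trans ?_ (EReal.le_mul_sub_add_mul hk hs hx hg)
    rw [EReal.coe_le_coe_iff]
    -- A constant is negligible after normalization because `h n ≥ 1`.
    have h1 : M * (1 / (a n * (T : ℝ) ^ p)) ≤ M * (h n / (a n * (T : ℝ) ^ p)) := by gcongr
    have h2 : 1 / a n * (0 + 1 / (T : ℝ) ^ p * -M) = -(M * (1 / (a n * (T : ℝ) ^ p))) := by
      field_simp
      ring
    linarith
  -- The witness is admissible because `δ < 1 / τ`.
  · refine (iInf₂_le (δ / n) ⟨by positivity, by gcongr⟩).trans ?_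
    have ex : 1 - 1 / τ / n + δ / n = 1 - (1 / τ - δ) / n := by ring
    rw [ex, e₁]
    have hg := quantile_le_of_measure_abs_ge_lt (htail T hT0) hδn
    have hx : (q₁ : EReal) ≤ (q₂ + e / 2 * a n : ℝ) := EReal.coe_le_coe_iff.2 (by linarith)
    refine (EReal.mul_sub_add_mul_le hk hs hx hg).trans ?_
    rw [EReal.coe_le_coe_iff]
    have h2 : 1 / a n * (e / 2 * a n + 1 / (T : ℝ) ^ p * (C * h n)) =
        e / 2 + C * (h n / (a n * (T : ℝ) ^ p)) := by
      field_simp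
    linarith

lemma teSup_of_hasTailScale : TESup F G p a l := by
  intro τ hτ
  obtain ⟨M, hM0, hM⟩ := htight.exists_measure_abs_ge_lt (η := ENNReal.ofReal (1 / 2)) (by simp)
  -- For `u ≤ 1 / 2` the noise quantile is at most a median, which tightness bounds uniformly in
  -- `T`.
  refine ⟨1 / 2, by norm_num, by norm_num, tendsto_zero_of_forall_eventually_abs_le fun e he => ?_⟩
  have ht : 0 < 1 / τ := by positivity
  obtain ⟨δ, hδ, hδt, hev⟩ := hF (1 / τ) (e / 2) ht (by positivity)
  obtain ⟨C, hC, hCev⟩ := hscale δ hδ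
  have hsmall : ∀ c : ℝ, ∀ r : ℝ, 0 < r → ∀ᶠ q : ℕ × ℕ in l,
      c * (h q.1 / (a q.1 * (q.2 : ℝ) ^ p)) < r := fun c r hr =>
    (tendsto_order.1 (hrate.const_mul c)).2 r (by simpa using hr)
  filter_upwards [hN.eventually hev, hN.eventually hCev, hN.eventually ha, hN.eventually hh,
    hN.eventually (eventually_gt_atTop 0), hT.eventually (eventually_gt_atTop 0),
    hN.eventually (eventually_div_natCast_lt_one (2 * δ)),
    hsmall C (e / 2) (by positivity), hsmall M e he]
    with ⟨n, T⟩ hinc htail han hhn hn hT0 hδn hC' hM'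
  simp only at hinc htail han hhn hn hT0 hδn hC' hM' ⊢
  have := hG T hT0
  have hn' : (0 : ℝ) < n := Nat.cast_pos.2 hn
  have hT' : (0 : ℝ) < T := Nat.cast_pos.2 hT0
  have hTp : 0 < (T : ℝ) ^ p := Real.rpow_pos_of_pos hT' p
  obtain ⟨-, q₂, q₃, -, e₂, e₃, -, hq⟩ := hinc
  have et : 1 / ((n : ℝ) * τ) = 1 / τ / n := by field_simp
  have hk : 0 ≤ 1 / a n := by positivity
  have hs : 0 ≤ 1 / (T : ℝ) ^ p := by positivity
  rw [et, e₂]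
  constructor
  · have hmem : δ / n ∈ Set.Icc (0 : ℝ) (1 / 2) := ⟨by positivity, by
      rw [mul_div_assoc] at hδn
      linarith⟩
    refine le_trans ?_ (le_iSup₂ (δ / (n : ℝ)) hmem)
    have ex : 1 - 1 / τ / n - δ / n = 1 - (1 / τ + δ) / n := by ring
    rw [ex, e₃]
    have hg := le_quantile_of_measure_abs_ge_lt (htail T hT0)
    have hx : ((q₂ + -(e / 2 * a n) : ℝ) : EReal) ≤ q₃ := EReal.coe_le_coe_iff.2 (by linarith)
    refine le_trans ?_ (EReal.le_mul_sub_add_mul hk hs hx hg)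
    rw [EReal.coe_le_coe_iff]
    have h2 : 1 / a n * (-(e / 2 * a n) + 1 / (T : ℝ) ^ p * -(C * h n)) =
        -(e / 2 + C * (h n / (a n * (T : ℝ) ^ p))) := by
      field_simp
      ring
    linarith
  · refine iSup₂_le fun u hu => ?_
    have hMT : (G T).real {x | M ≤ |x|} < 1 / 2 :=
      ENNReal.toReal_lt_of_lt_ofReal (hM _ ⟨T, hT0, rfl⟩)
    have hg : quantile (G T) u ≤ M :=
      (quantile_mono _ (by linarith [hu.2])).trans
        (quantile_le_of_measure_abs_ge_lt hMT (by norm_num))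
    have hx : quantile F (1 - 1 / τ / n - u) ≤ (q₂ + 0 : ℝ) := by
      rw [add_zero, ← e₂]
      exact quantile_mono F (by linarith [hu.1])
    refine (EReal.mul_sub_add_mul_le hk hs hx hg).trans ?_
    rw [EReal.coe_le_coe_iff]
    have h1 : M * (1 / (a n * (T : ℝ) ^ p)) ≤ M * (h n / (a n * (T : ℝ) ^ p)) := by gcongr
    have h2 : 1 / a n * (0 + 1 / (T : ℝ) ^ p * M) = M * (1 / (a n * (T : ℝ) ^ p)) := by
      field_simp
      ring
    linarith

end TailEquivalence

/-! ### Transfer of the rate conditions and conclusion -/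

/-- If `a n` grows at least like `n ^ γ'`, rates relative to `n ^ γ'` carry over to `a n`. -/
lemma tendsto_div_mul_rpow_of_le {a h : ℕ → ℝ} {l : Filter (ℕ × ℕ)} {p γ' c : ℝ}
    (hN : Tendsto Prod.fst l atTop) (hT : Tendsto Prod.snd l atTop) (hc : 0 < c)
    (hca : ∀ᶠ n : ℕ in atTop, c * (n : ℝ) ^ γ' ≤ a n) (hh : ∀ᶠ n in atTop, 1 ≤ h n)
    (hrate : Tendsto (fun q : ℕ × ℕ => (q.1 : ℝ) ^ (-γ') * h q.1 / (q.2 : ℝ) ^ p) l (𝓝 0)) :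
    Tendsto (fun q : ℕ × ℕ => h q.1 / (a q.1 * (q.2 : ℝ) ^ p)) l (𝓝 0) := by
  have hlim := hrate.const_mul c⁻¹
  rw [mul_zero] at hlim
  have key : ∀ᶠ q in l, 0 ≤ h q.1 / (a q.1 * (q.2 : ℝ) ^ p) ∧ h q.1 / (a q.1 * (q.2 : ℝ) ^ p) ≤
      c⁻¹ * ((q.1 : ℝ) ^ (-γ') * h q.1 / (q.2 : ℝ) ^ p) := by
    filter_upwards [hN.eventually hca, hN.eventually hh, hN.eventually (eventually_gt_atTop 0),
      hT.eventually (eventually_gt_atTop 0)] with ⟨n, T⟩ hcn hhn hn hT0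
    simp only at hcn hhn hn hT0 ⊢
    have hTp : 0 < (T : ℝ) ^ p := Real.rpow_pos_of_pos (Nat.cast_pos.2 hT0) p
    have hnγ : 0 < (n : ℝ) ^ γ' := Real.rpow_pos_of_pos (Nat.cast_pos.2 hn) γ'
    have han : 0 < a n := (mul_pos hc hnγ).trans_le hcn
    refine ⟨by positivity, ?_⟩
    calc h n / (a n * (T : ℝ) ^ p) ≤ h n / (c * (n : ℝ) ^ γ' * (T : ℝ) ^ p) := by gcongr
      _ = _ := by
        rw [Real.rpow_neg (Nat.cast_nonneg n)]
        field_simp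
  exact tendsto_of_tendsto_of_tendsto_of_le_of_le' tendsto_const_nhds hlim
    (key.mono fun _ h => h.1) (key.mono fun _ h => h.2)

/-- Either rate condition provides a tail scale `h` of the noise for which `n ^ γ' * T ^ p`
dominates `h n`. -/
lemma exists_hasTailScale {Ω : Type*} [MeasurableSpace Ω] {P : Measure Ω}
    {θ : ℕ → Ω → ℝ} {ε : ℕ → ℕ → Ω → ℝ} {F : Measure ℝ} {G : ℕ → Measure ℝ}
    (hsample : IsNoisySample P θ ε F G) (htight : IsTightMeasureSet (G '' Set.Ioi 0)) {p γ' : ℝ}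
    {l : Filter (ℕ × ℕ)} (hN : Tendsto Prod.fst l atTop) (hT : Tendsto Prod.snd l atTop)
    (hrate : MomentRate P ε p γ' l ∨ GaussianRate P ε p γ' l) :
    ∃ h : ℕ → ℝ, HasTailScale G h ∧ (∀ᶠ n in atTop, 1 ≤ h n) ∧
      Tendsto (fun q : ℕ × ℕ => (q.1 : ℝ) ^ (-γ') * h q.1 / (q.2 : ℝ) ^ p) l (𝓝 0) := by
  rcases hrate with ⟨β, hβ, hmom, hlim⟩ | ⟨hgauss, hlim⟩
  · refine ⟨fun n => (n : ℝ) ^ (1 / β), HasTailScale.of_moment hmom.ne hβ fun T hT0 => ?_, ?_, ?_⟩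
    · rw [← (hsample.law_noise T hT0 0).lintegral_comp (f := fun x => ‖x‖ₑ ^ β) (by fun_prop)]
      exact (le_iSup (fun i => ∫⁻ ω, ‖ε T i ω‖ₑ ^ β ∂P) 0).trans
        (le_iSup₂ (f := fun T (_ : T ∈ Set.Ioi 0) => ⨆ i : ℕ, ∫⁻ ω, ‖ε T i ω‖ₑ ^ β ∂P) T hT0)
    · filter_upwards [eventually_ge_atTop 1] with n hn
      exact Real.one_le_rpow (by exact_mod_cast hn) (by positivity)
    · have hlogT : Tendsto (fun T : ℕ => Real.log T) atTop atTop :=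
        Real.tendsto_log_atTop.comp tendsto_natCast_atTop_atTop
      refine squeeze_zero' (Eventually.of_forall fun q => by positivity) ?_ hlim
      filter_upwards [hN.eventually (eventually_gt_atTop 0),
        hT.eventually (hlogT.eventually_ge_atTop 1)] with ⟨n, T⟩ hn hlog
      simp only at hn hlog ⊢
      have hn' : (0 : ℝ) < n := Nat.cast_pos.2 hn
      rw [← Real.rpow_add hn', neg_add_eq_sub]
      gcongr
      -- Since `log T ≥ 1` eventually, inserting its power only enlarges the bound.
      exact le_mul_of_one_le_right (by positivity) (Real.one_le_rpow hlog (by positivity))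
  · refine ⟨fun n => √(Real.log n), HasTailScale.of_gaussian htight fun T hT0 => ?_, ?_, hlim⟩
    · obtain ⟨m, v, hmv⟩ := hgauss T hT0
      exact ⟨m, v, (hsample.law_noise T hT0 0).map_eq.symm.trans (hmv 0).map_eq⟩
    · have hlog : Tendsto (fun n : ℕ => Real.log n) atTop atTop :=
        Real.tendsto_log_atTop.comp tendsto_natCast_atTop_atTop
      filter_upwards [hlog.eventually_ge_atTop 1] with n hn
      exact Real.one_le_sqrt.2 hn

theorem proposition1
    {Ω : Type*} [MeasurableSpace Ω] (P : Measure Ω) [IsProbabilityMeasure P]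
    {Ω' : Type*} [MeasurableSpace Ω'] (P' : Measure Ω') [IsProbabilityMeasure P']
    (θ : ℕ → Ω → ℝ) (ε : ℕ → ℕ → Ω → ℝ)
    (F : Measure ℝ) (G : ℕ → Measure ℝ)
    (hsample : IsNoisySample P θ ε F G)
    (htight : IsTightMeasureSet (G '' Set.Ioi 0))
    (p : ℝ) (hp : 0 < p)
    -- the asymptotic regime along which `(N, T) → (∞, ∞)`
    (l : Filter (ℕ × ℕ)) (hN : Tendsto Prod.fst l atTop) (hT : Tendsto Prod.snd l atTop)
    (γ γ' : ℝ) (hrate : MomentRate P ε p γ' l ∨ GaussianRate P ε p γ' l)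
    (hF : InDomainOfAttraction F γ) (hγ : γ' < γ)
    -- an arbitrary normalization with a non-degenerate weak limit of the noiseless maximum
    (a b : ℕ → ℝ) (ha : ∀ᶠ n in atTop, 0 < a n)
    (X : Ω' → ℝ) (hX : ¬ ∃ c : ℝ, X =ᵐ[P'] fun _ => c)
    (hconv : TendstoInDistribution (fun n ω => (sampleMax θ n ω - b n) / a n) atTop X
      (fun _ => P) P') :
    TEInf F G p a l ∧ TESup F G p a l := by
  have hFp : IsProbabilityMeasure F := (hsample.law_effect 0).isProbabilityMeasure_iff.1 ‹_›
  have hGp : ∀ T, 0 < T → IsProbabilityMeasure (G T) := fun T hT0 =>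
    (hsample.law_noise T hT0 0).isProbabilityMeasure_iff.1 ‹_›
  -- The effects do not depend on `T`, so the independence of the pairs at `T = 1` suffices.
  have hind : iIndepFun θ P := (hsample.indep 1 one_pos).comp (fun _ => Prod.fst)
    fun _ => measurable_fst
  obtain ⟨α, β, hα⟩ := hF.exists_isEVNormalization
  obtain ⟨c, hc, hca⟩ := hα.exists_scale_le hsample.law_effect hind ha hconv
  obtain ⟨d, hd, hdα⟩ := hα.exists_rpow_le_scale hγ
  obtain ⟨h, hscale, hh, hlim⟩ := exists_hasTailScale hsample htight hN hT hrate
  have hinc := hα.hasSmallQuantileIncrements hc hca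
  have hlow : ∀ᶠ n : ℕ in atTop, c * d * (n : ℝ) ^ γ' ≤ a n := by
    filter_upwards [hca, hdα] with n h1 h2
    rw [mul_assoc]
    exact (mul_le_mul_of_nonneg_left h2 hc.le).trans h1
  have hratio := tendsto_div_mul_rpow_of_le hN hT (mul_pos hc hd) hlow hh hlim
  exact ⟨teInf_of_hasTailScale hGp htight hN hT ha hh hscale hinc hratio,
    teSup_of_hasTailScale hGp htight hN hT ha hh hscale hinc hratio⟩
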